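/- **Theorem.** Let $n\ge 4$ and let $\mathbf C_n=(\{0,1,\dots,n-1\};\wedge,\vee,\to,\bot,\top)$ be the $n$-element Heyting chain ($0<1<\cdots<n-1$, $\bot=0$, $\top=n-1$, $a\to b=\top$ if $a\le b$ and $a\to b=b$ otherwise). Let $\mathcal G_n=\mathbb{ISP}(\mathbf C_n)$ be the class of all algebras isomorphic to a subalgebra of a power of $\mathbf C_n$, with all Heyting homomorphisms as morphisms. For $1\le i\le n-2$ let $h_i$ be the endomorphism of $\mathbf C_n$ with $h_i(x)=x+1$ if $i\le x<n-1$ and $h_i(x)=x$ otherwise. For $1\le i\le n-3$ let $g_i$ be the partial endomorphism with domain $C_n\setminus\{i\}$ given by $g_i(i+1)=i$ and $g_i(x)=x$ for $x\neq i+1$, and let $f_i\colon C_n\setminus\{i+1\}\to C_n\setminus\{i\}$ be the inverse of $g_i$. Put $$\Sigma_n=\{f_1,g_1\}\times\cdots\times\{f_{n-3},g_{n-3}\}\times\{h_1,\dots,h_{n-2}\}.$$ For $\sigma\in\Sigma_n$ consider the alter ego $(C_n;\sigma,\mathscr T)$: the set $C_n$ with the discrete topology $\mathscr T$ and with the components of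 $\sigma$ as operations and partial operations. For $\mathbf A\in\mathcal G_n$, let $D(\mathbf A)$ be the set of all homomorphisms $\mathbf A\to\mathbf C_n$, with the topology induced by the product topology on $C_n^A$ and with the components of $\sigma$ lifted pointwise (a partial operation $p$ is defined at $x\in D(\mathbf A)$ if and only if $x(a)\in\operatorname{dom}p$ for all $a\in A$). Let $ED(\mathbf A)$ be the algebra, with operations defined pointwise from $\mathbf C_n$, of all continuous maps $\varphi\colon D(\mathbf A)\to C_n$ that preserve the components of $\sigma$: $\varphi(h(x))=h(\varphi(x))$ for the total component $h$, and, for each partial component $p$, if $x\in\operatorname{dom}p$ then $\varphi(x)\in\operatorname{dom}p$ and $\varphi(p(x))=p(\varphi(x))$. Then for every $\sigma\in\Sigma_n$ the alter ego $(C_n;\sigma,\mathscr T)$ yields a duality on $\mathcal G_n$: for every $\mathbf A\in\mathcal G_n$ the evaluation map $e_{\mathbf A}\colon\mathbf A\to ED(\mathbf A)$, $e_{\mathbf A}(a)(x)=x(a)$, is an isomorphism. Each of these alter egos has exactly $n-3$ (non-total) partial endomorphisms, each of them one of the $f_i$ or $g_i$, and exactly one endomorphism, one of the $h_j$; and there are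 exactly $2^{n-3}(n-2)$ distinct alter egos of this form. -/

import Mathlib

universe u v

namespace GoedelDuality

noncomputable section

/-! The Heyting chain with `n` elements `0 < 1 < ⋯ < n - 1`. -/

/-- The `n`-element Heyting chain, with its order, its Heyting algebra structure and its discrete
topology. -/
abbrev C (n : ℕ) : Type := Fin n

section Chain

variable {n : ℕ} [NeZero n]

theorem bot_val : ((⊥ : C n) : ℕ) = 0 := by
  have h : (⊥ : C n) ≤ ⟨0, Nat.pos_of_ne_zero (NeZero.ne n)⟩ := bot_le
  have h' : ((⊥ : C n) : ℕ) ≤ 0 := h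
  omega

theorem top_val : ((⊤ : C n) : ℕ) = n - 1 := by
  have hn := Nat.pos_of_ne_zero (NeZero.ne n)
  have h : (⟨n - 1, by omega⟩ : C n) ≤ ⊤ := le_top
  have h' : n - 1 ≤ ((⊤ : C n) : ℕ) := h
  have := (⊤ : C n).isLt
  omega

/-- The implication of the chain: `a → b` is the top if `a ≤ b`, and `b` otherwise. -/
theorem himp_chain (a b : C n) : a ⇨ b = if a ≤ b then ⊤ else b := by
  split_ifs with h
  · exact himp_eq_top_iff.2 h
  · apply le_antisymm
    · rcases le_total (a ⇨ b) a with h1 | h1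
      · have := himp_inf_le (a := a) (b := b)
        rwa [inf_eq_left.2 h1] at this
      · have := himp_inf_le (a := a) (b := b)
        rw [inf_eq_right.2 h1] at this
        exact absurd this h
    · exact le_himp

end Chain

/-- `A` belongs to the quasivariety generated by the `n`-element Heyting chain: `A` is isomorphic to
a subalgebra of a power of the chain, that is, it embeds into such a power. The empty index set
(the one-element algebra) is allowed. -/
def InISP (n : ℕ) [NeZero n] (A : Type u) [HeytingAlgebra A] : Prop :=
  ∃ (I : Type u) (e : HeytingHom A (I → C n)), Function.Injective e

/-- A non-total partial endomorphism of the `n`-element chain: a homomorphism into the chain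
defined on a proper subalgebra. -/
structure PartialEnd (n : ℕ) [NeZero n] where
  /-- the domain -/
  dom : Set (C n)
  /-- the map -/
  toFun : dom → C n
  bot_mem : ⊥ ∈ dom
  top_mem : ⊤ ∈ dom
  inf_mem : ∀ {a b}, a ∈ dom → b ∈ dom → a ⊓ b ∈ dom
  sup_mem : ∀ {a b}, a ∈ dom → b ∈ dom → a ⊔ b ∈ dom
  himp_mem : ∀ {a b}, a ∈ dom → b ∈ dom → a ⇨ b ∈ dom
  map_bot : toFun ⟨⊥, bot_mem⟩ = ⊥
  map_top : toFun ⟨⊤, top_mem⟩ = ⊤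
  map_inf : ∀ a b : dom, toFun ⟨a ⊓ b, inf_mem a.2 b.2⟩ = toFun a ⊓ toFun b
  map_sup : ∀ a b : dom, toFun ⟨a ⊔ b, sup_mem a.2 b.2⟩ = toFun a ⊔ toFun b
  map_himp : ∀ a b : dom, toFun ⟨a ⇨ b, himp_mem a.2 b.2⟩ = toFun a ⇨ toFun b
  /-- the domain is not the whole chain -/
  dom_ne : dom ≠ Set.univ

/-- An alter ego `(C_n; G, H, 𝒯)`: a set `G` of endomorphisms and a set `H` of non-total partial
endomorphisms; `𝒯` is always the discrete topology. -/
@[ext]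
structure AlterEgo (n : ℕ) [NeZero n] where
  /-- the endomorphisms -/
  G : Set (HeytingHom (C n) (C n))
  /-- the non-total partial endomorphisms -/
  H : Set (PartialEnd n)

/-! Topological structures of the same type as an alter ego, and their morphisms. -/

section Structures

variable {n : ℕ} [NeZero n]

/-- A topological structure of the same type as the alter ego `M`: a topological space with a total
unary operation for each member of `G` and a partial unary operation for each member of `H`. -/
structure TopStr (M : AlterEgo n) where
  /-- the underlying set -/
  carrier : Type u
  /-- the topology -/
  top : TopologicalSpace carrier
  /-- the total operations -/
  op : M.G → carrier → carrier
  /-- the domains of the partial operations -/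
  pdom : M.H → Set carrier
  /-- the partial operations -/
  pop : (p : M.H) → pdom p → carrier

instance (M : AlterEgo n) (X : TopStr.{u} M) : TopologicalSpace X.carrier := X.top

/-- The alter ego itself, as a topological structure. -/
def AlterEgo.toTopStr (M : AlterEgo n) : TopStr.{0} M where
  carrier := C n
  top := inferInstance
  op g := g.1
  pdom p := p.1.dom
  pop p := p.1.toFun

/-- Continuous structure-preserving maps. A partial operation is preserved if its domain is mapped
into the corresponding domain and the map commutes with the operation there. -/
structure TopStr.Hom {M : AlterEgo n} (X : TopStr.{u} M) (Y : TopStr.{v} M) where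
  /-- the map -/
  toFun : X.carrier → Y.carrier
  continuous_toFun : Continuous toFun
  map_op : ∀ (g : M.G) (x : X.carrier), toFun (X.op g x) = Y.op g (toFun x)
  map_pdom : ∀ (p : M.H) (x : X.carrier), x ∈ X.pdom p → toFun x ∈ Y.pdom p
  map_pop : ∀ (p : M.H) (x : X.pdom p),
    toFun (X.pop p x) = Y.pop p ⟨toFun x, map_pdom p x x.2⟩

/-- `E(X)`: the set of morphisms from `X` to the alter ego. -/
abbrev E {M : AlterEgo n} (X : TopStr.{u} M) : Type u := X.Hom M.toTopStr

namespace E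

variable {M : AlterEgo n} {X : TopStr.{u} M}

/-- The map underlying a member of `E(X)`, with values in the chain. -/
def fn (φ : E X) : X.carrier → C n := φ.toFun

theorem fn_injective : Function.Injective (fn : E X → X.carrier → C n) := by
  rintro ⟨f, _, _, _, _⟩ ⟨g, _, _, _, _⟩ h
  have : f = g := h
  subst this
  rfl

theorem continuous_fn (φ : E X) : Continuous φ.fn := φ.continuous_toFun

theorem fn_op (φ : E X) (g : M.G) (x : X.carrier) : φ.fn (X.op g x) = g.1 (φ.fn x) :=
  φ.map_op g x

theorem fn_pdom (φ : E X) (p : M.H) (x : X.pdom p) : φ.fn x ∈ p.1.dom := φ.map_pdom p x x.2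

theorem fn_pop (φ : E X) (p : M.H) (x : X.pdom p) :
    φ.fn (X.pop p x) = p.1.toFun ⟨φ.fn x, φ.fn_pdom p x⟩ := φ.map_pop p x

/-- The operations of `E(X)` are inherited pointwise from the chain. -/
instance : Bot (E X) where
  bot :=
    { toFun := fun _ => (⊥ : C n)
      continuous_toFun := continuous_const
      map_op := fun g _ => (BotHomClass.map_bot g.1).symm
      map_pdom := fun p _ _ => p.1.bot_mem
      map_pop := fun p _ => p.1.map_bot.symm }

instance : Top (E X) where
  top :=
    { toFun := fun _ => (⊤ : C n)
      continuous_toFun := continuous_const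
      map_op := fun g _ => (TopHomClass.map_top g.1).symm
      map_pdom := fun p _ _ => p.1.top_mem
      map_pop := fun p _ => p.1.map_top.symm }

instance : Min (E X) where
  min φ ψ :=
    { toFun := fun x => (φ.fn x ⊓ ψ.fn x : C n)
      continuous_toFun := (continuous_of_discreteTopology (f := fun q : C n × C n => q.1 ⊓ q.2)).comp
        (φ.continuous_fn.prodMk ψ.continuous_fn)
      map_op := fun g x => by
        rw [fn_op, fn_op]
        have := map_inf (β := C n) g.1 (φ.fn x) (ψ.fn x)
        exact this.symm
      map_pdom := fun p x hx => p.1.inf_mem (φ.fn_pdom p ⟨x, hx⟩) (ψ.fn_pdom p ⟨x, hx⟩)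
      map_pop := fun p x => by
        rw [fn_pop, fn_pop]
        exact (p.1.map_inf ⟨_, φ.fn_pdom p x⟩ ⟨_, ψ.fn_pdom p x⟩).symm }

instance : Max (E X) where
  max φ ψ :=
    { toFun := fun x => (φ.fn x ⊔ ψ.fn x : C n)
      continuous_toFun := (continuous_of_discreteTopology (f := fun q : C n × C n => q.1 ⊔ q.2)).comp
        (φ.continuous_fn.prodMk ψ.continuous_fn)
      map_op := fun g x => by
        rw [fn_op, fn_op]
        have := map_sup (β := C n) g.1 (φ.fn x) (ψ.fn x)
        exact this.symm
      map_pdom := fun p x hx => p.1.sup_mem (φ.fn_pdom p ⟨x, hx⟩) (ψ.fn_pdom p ⟨x, hx⟩)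
      map_pop := fun p x => by
        rw [fn_pop, fn_pop]
        exact (p.1.map_sup ⟨_, φ.fn_pdom p x⟩ ⟨_, ψ.fn_pdom p x⟩).symm }

instance : HImp (E X) where
  himp φ ψ :=
    { toFun := fun x => (φ.fn x ⇨ ψ.fn x : C n)
      continuous_toFun := (continuous_of_discreteTopology (f := fun q : C n × C n => q.1 ⇨ q.2)).comp
        (φ.continuous_fn.prodMk ψ.continuous_fn)
      map_op := fun g x => by
        rw [fn_op, fn_op]
        have := map_himp (β := C n) g.1 (φ.fn x) (ψ.fn x)
        exact this.symm
      map_pdom := fun p x hx => p.1.himp_mem (φ.fn_pdom p ⟨x, hx⟩) (ψ.fn_pdom p ⟨x, hx⟩)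
      map_pop := fun p x => by
        rw [fn_pop, fn_pop]
        exact (p.1.map_himp ⟨_, φ.fn_pdom p x⟩ ⟨_, ψ.fn_pdom p x⟩).symm }

instance : Compl (E X) := ⟨fun φ => φ ⇨ ⊥⟩

instance : LE (E X) := ⟨fun φ ψ => φ.fn ≤ ψ.fn⟩

instance : LT (E X) := ⟨fun φ ψ => φ.fn < ψ.fn⟩

/-- `E(X)` is a Heyting algebra, as a subalgebra of a power of the chain. -/
instance : HeytingAlgebra (E X) :=
  Function.Injective.heytingAlgebra fn fn_injective Iff.rfl Iff.rfl (fun _ _ => rfl)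
    (fun _ _ => rfl) rfl rfl (fun φ => himp_bot φ.fn) (fun _ _ => rfl)

end E

/-- `D(A)`: the set of homomorphisms from `A` to the chain, with the topology induced by the product
topology of the `A`-th power of the chain, and with the operations and partial operations of the
alter ego lifted pointwise: a partial operation `p` is defined at `x` exactly if all values of `x`
lie in the domain of `p`. -/
def D (M : AlterEgo n) (A : Type u) [HeytingAlgebra A] : TopStr.{u} M where
  carrier := HeytingHom A (C n)
  top := TopologicalSpace.induced (fun x a => x a) (inferInstanceAs (TopologicalSpace (A → C n)))
  op g x := g.1.comp x
  pdom p := {x | ∀ a, x a ∈ p.1.dom}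
  pop p x :=
    { toFun := fun a => p.1.toFun ⟨x.1 a, x.2 a⟩
      map_sup' := fun a b => by
        rw [← p.1.map_sup ⟨x.1 a, x.2 a⟩ ⟨x.1 b, x.2 b⟩]
        congr 2
        exact map_sup x.1 a b
      map_inf' := fun a b => by
        rw [← p.1.map_inf ⟨x.1 a, x.2 a⟩ ⟨x.1 b, x.2 b⟩]
        congr 2
        exact map_inf x.1 a b
      map_bot' := by
        refine Eq.trans ?_ p.1.map_bot
        congr 2
        exact map_bot x.1
      map_himp' := fun a b => by
        rw [← p.1.map_himp ⟨x.1 a, x.2 a⟩ ⟨x.1 b, x.2 b⟩]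
        congr 2
        exact map_himp x.1 a b }

/-- The evaluation homomorphism `e_A : A → E(D(A))`, `e_A(a)(x) = x(a)`. -/
def evalHom (M : AlterEgo n) (A : Type u) [HeytingAlgebra A] : HeytingHom A (E (D M A)) where
  toFun a :=
    { toFun := fun x : HeytingHom A (C n) => x a
      continuous_toFun := (continuous_apply a).comp continuous_induced_dom
      map_op := fun _ _ => rfl
      map_pdom := fun _ _ hx => hx a
      map_pop := fun _ _ => rfl }
  map_sup' a b := E.fn_injective (funext fun x : HeytingHom A (C n) => map_sup x a b)
  map_inf' a b := E.fn_injective (funext fun x : HeytingHom A (C n) => map_inf x a b)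
  map_bot' := E.fn_injective (funext fun x : HeytingHom A (C n) => map_bot x)
  map_himp' a b := E.fn_injective (funext fun x : HeytingHom A (C n) => map_himp x a b)

/-- `M` yields a duality on the algebra `A`: the evaluation homomorphism `A → E(D(A))` is an
isomorphism. -/
def YieldsDualityOn (M : AlterEgo n) (A : Type u) [HeytingAlgebra A] : Prop :=
  Function.Bijective (evalHom M A)

/-- `M` yields a (natural) duality on the quasivariety generated by the `n`-element chain. -/
def YieldsDuality (M : AlterEgo n) : Prop :=
  ∀ (A : Type u) [HeytingAlgebra A], InISP n A → YieldsDualityOn M A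

end Structures

/-! The particular endomorphisms and partial endomorphisms. -/

section Maps

variable {n : ℕ} [NeZero n]

/-- The endomorphism `h_i`, for `1 ≤ i ≤ n - 2`: `x ↦ x + 1` if `i ≤ x < n - 1`, and `x ↦ x`
otherwise. -/
def h (i : ℕ) (hi : 1 ≤ i) (_hin : i + 2 ≤ n) : HeytingHom (C n) (C n) :=
  let F : C n → C n := fun x => if hx : i ≤ x.val ∧ x.val + 1 < n then ⟨x.val + 1, hx.2⟩ else x
  have hF : ∀ x, (F x).val = if i ≤ x.val ∧ x.val + 1 < n then x.val + 1 else x.val := by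
    intro x; simp only [F]; split_ifs <;> rfl
  have mono : Monotone F := by
    intro x y hxy
    have hxy' : x.val ≤ y.val := hxy
    have hx := x.isLt
    have hy := y.isLt
    change (F x).val ≤ (F y).val
    rw [hF, hF]
    split_ifs <;> omega
  { toFun := F
    map_sup' := fun a b => mono.map_sup a b
    map_inf' := fun a b => mono.map_inf a b
    map_bot' := by
      apply Fin.ext
      rw [hF, bot_val, if_neg (by omega)]
    map_himp' := fun a b => by
      have ha := a.isLt
      have hb := b.isLt
      rw [himp_chain, himp_chain]
      by_cases hab : a ≤ b
      · rw [if_pos hab, if_pos (mono hab)]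
        apply Fin.ext
        rw [hF, top_val, if_neg (by omega)]
      · rw [if_neg hab]
        have hab' : b.val < a.val := not_le.1 hab
        split_ifs with h2
        · have h3 : (F a).val ≤ (F b).val := h2
          apply Fin.ext
          rw [hF, hF] at h3
          rw [hF, top_val]
          split_ifs at h3 ⊢ <;> omega
        · rfl }

/-- A partial endomorphism of the chain from an injective monotone map that is defined on all
elements except one, different from the bounds, and that preserves the bounds. -/
def PartialEnd.ofMap (c : C n) (hc : c ≠ ⊥) (hc' : c ≠ ⊤) (F : C n → C n)
    (mono : ∀ x y, x ≠ c → y ≠ c → x < y → F x < F y) (hbot : F ⊥ = ⊥) (htop : F ⊤ = ⊤) :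
    PartialEnd n where
  dom := {x | x ≠ c}
  toFun x := F x.1
  bot_mem := hc.symm
  top_mem := hc'.symm
  inf_mem {a b} ha hb := by
    rcases min_choice a b with h | h
    · rw [h]; exact ha
    · rw [h]; exact hb
  sup_mem {a b} ha hb := by
    rcases max_choice a b with h | h
    · rw [h]; exact ha
    · rw [h]; exact hb
  himp_mem {a b} _ hb := by
    rw [himp_chain]
    split_ifs
    · exact hc'.symm
    · exact hb
  map_bot := hbot
  map_top := htop
  map_inf := by
    rintro ⟨a, ha⟩ ⟨b, hb⟩
    rcases lt_trichotomy a b with h | h | h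
    · simp only [inf_eq_left.2 h.le, inf_eq_left.2 (mono a b ha hb h).le]
    · subst h; simp
    · simp only [inf_eq_right.2 h.le, inf_eq_right.2 (mono b a hb ha h).le]
  map_sup := by
    rintro ⟨a, ha⟩ ⟨b, hb⟩
    rcases lt_trichotomy a b with h | h | h
    · simp only [sup_eq_right.2 h.le, sup_eq_right.2 (mono a b ha hb h).le]
    · subst h; simp
    · simp only [sup_eq_left.2 h.le, sup_eq_left.2 (mono b a hb ha h).le]
  map_himp := by
    rintro ⟨a, ha⟩ ⟨b, hb⟩
    simp only [himp_chain]
    rcases lt_trichotomy a b with h | h | h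
    · rw [if_pos h.le, if_pos (mono a b ha hb h).le, htop]
    · subst h; simp [htop]
    · rw [if_neg (not_le.2 h), if_neg (not_le.2 (mono b a hb ha h))]
  dom_ne h := by
    have : c ∈ {x : C n | x ≠ c} := h ▸ Set.mem_univ c
    exact this rfl

/-- The partial endomorphism `g_i`, for `1 ≤ i ≤ n - 3`, with domain `C_n \ {i}`: `i + 1 ↦ i`, and
`x ↦ x` otherwise. -/
def g (i : ℕ) (hi : 1 ≤ i) (hin : i + 3 ≤ n) : PartialEnd n :=
  PartialEnd.ofMap ⟨i, by omega⟩
    (fun h => by have := congrArg Fin.val h; rw [bot_val] at this; simp at this; omega)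
    (fun h => by have := congrArg Fin.val h; rw [top_val] at this; simp at this; omega)
    (fun x => if x.val = i + 1 then ⟨i, by omega⟩ else x)
    (fun x y hx hy hxy => by
      have hxy' : x.val < y.val := hxy
      have hx' : x.val ≠ i := fun h => hx (Fin.ext h)
      have hy' : y.val ≠ i := fun h => hy (Fin.ext h)
      rw [Fin.lt_def]
      split_ifs <;> simp <;> omega)
    (if_neg (by rw [bot_val]; omega)) (if_neg (by rw [top_val]; omega))

/-- The partial endomorphism `f_i`, for `1 ≤ i ≤ n - 3`, with domain `C_n \ {i + 1}`, the inverse of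
`g_i`: `i ↦ i + 1`, and `x ↦ x` otherwise. -/
def f (i : ℕ) (hi : 1 ≤ i) (hin : i + 3 ≤ n) : PartialEnd n :=
  PartialEnd.ofMap ⟨i + 1, by omega⟩
    (fun h => by have := congrArg Fin.val h; rw [bot_val] at this; simp at this)
    (fun h => by have := congrArg Fin.val h; rw [top_val] at this; simp at this; omega)
    (fun x => if x.val = i then ⟨i + 1, by omega⟩ else x)
    (fun x y hx hy hxy => by
      have hxy' : x.val < y.val := hxy
      have hx' : x.val ≠ i + 1 := fun h => hx (Fin.ext h)
      have hy' : y.val ≠ i + 1 := fun h => hy (Fin.ext h)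
      rw [Fin.lt_def]
      split_ifs <;> simp <;> omega)
    (if_neg (by rw [bot_val]; omega)) (if_neg (by rw [top_val]; omega))

variable (n) in
/-- `Σ_n = {f_1, g_1} × ⋯ × {f_{n-3}, g_{n-3}} × {h_1, …, h_{n-2}}`. The components with index
`1, …, n - 3` are listed by `Fin (n - 3)`. -/
def Sigma : Set ((Fin (n - 3) → PartialEnd n) × HeytingHom (C n) (C n)) :=
  {σ | (∀ k : Fin (n - 3),
          σ.1 k = f (k.val + 1) (by omega) (by omega) ∨
          σ.1 k = g (k.val + 1) (by omega) (by omega)) ∧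
       ∃ (j : ℕ) (hj : 1 ≤ j) (hjn : j + 2 ≤ n), σ.2 = h j hj hjn}

/-- The alter ego `(C_n; σ, 𝒯)`, whose operations and partial operations are the components
of `σ`. -/
def alterEgo (σ : (Fin (n - 3) → PartialEnd n) × HeytingHom (C n) (C n)) : AlterEgo n where
  G := {σ.2}
  H := Set.range σ.1

end Maps

end

end GoedelDuality

/-! Only the graphs of the operations matter. The converse of the graph of `f i` is the graph of `g
i`, so a member of `E (D M A)` preserves the same relation whichever of the two is present. Since `g
i ∘ h i = h (i + 1)` and `f i ∘ h (i + 1) = h i`, preserving one raising relation together with all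
shift relations forces all raising relations. Hence every choice of `σ` imposes the same
constraints.

Let `ψ` satisfy these constraints. The raising maps turn the prime filter `{a | i ≤ x a}`, for `i ≥
1`, into the preimage of the top under another homomorphism; the shifts then close the holes in the
range of that homomorphism, after which it is determined by the filter. So the truth of `i ≤ ψ x`
depends only on this filter (`le_iff_le_of_preservesRel`). An argument with implication derives from
this that every two values of `ψ` are bounded, one from below and one from above, by those of a
single evaluation (`exists_le_apply_and_apply_le`).

Compactness of `D M A` combines these two-point bounds into an exact evaluation
(`exists_evalHom_eq`). Injectivity of the evaluation map comes from the coordinates of an embedding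
into a power of the chain. The count is separate: the elements moved by a component reveal which
component it is. -/

namespace GoedelDuality

/-! ### Preserved relations and their independence of the choice of `σ`. -/

section Relations

variable {n : ℕ} [NeZero n] {A : Type u} [HeytingAlgebra A]

/-- The graph of the partial endomorphism `g_i`, and the converse of the graph of `f_i`. -/
def ShiftRel (i u v : ℕ) : Prop := (u = i + 1 ∧ v = i) ∨ (u ≠ i ∧ u ≠ i + 1 ∧ v = u)

/-- The graph of the endomorphism `h_j`. -/
def RaiseRel (n j u v : ℕ) : Prop := (j ≤ u ∧ u + 1 < n ∧ v = u + 1) ∨ (¬(j ≤ u ∧ u + 1 < n) ∧ v = u)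

theorem h_apply_val (j : ℕ) (hj : 1 ≤ j) (hjn : j + 2 ≤ n) (x : C n) :
    (h j hj hjn x).val = if j ≤ x.val ∧ x.val + 1 < n then x.val + 1 else x.val := by
  change (dite _ _ _ : C n).val = _
  split_ifs <;> rfl

theorem raiseRel_h (j : ℕ) (hj : 1 ≤ j) (hjn : j + 2 ≤ n) (x : C n) :
    RaiseRel n j x.val (h j hj hjn x).val := by
  rw [h_apply_val]
  unfold RaiseRel
  split_ifs <;> omega

theorem mem_g_dom {i : ℕ} {hi : 1 ≤ i} {hin : i + 3 ≤ n} {x : C n} :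
    x ∈ (g i hi hin).dom ↔ x.val ≠ i :=
  (Fin.ext_iff (b := (⟨i, by omega⟩ : Fin n))).not

theorem mem_f_dom {i : ℕ} {hi : 1 ≤ i} {hin : i + 3 ≤ n} {x : C n} :
    x ∈ (f i hi hin).dom ↔ x.val ≠ i + 1 :=
  (Fin.ext_iff (b := (⟨i + 1, by omega⟩ : Fin n))).not

theorem g_apply_val {i : ℕ} {hi : 1 ≤ i} {hin : i + 3 ≤ n} (x : (g i hi hin).dom) :
    ((g i hi hin).toFun x).val = if x.1.val = i + 1 then i else x.1.val := by
  change (ite _ _ _ : C n).val = _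
  split_ifs <;> rfl

theorem f_apply_val {i : ℕ} {hi : 1 ≤ i} {hin : i + 3 ≤ n} (x : (f i hi hin).dom) :
    ((f i hi hin).toFun x).val = if x.1.val = i then i + 1 else x.1.val := by
  change (ite _ _ _ : C n).val = _
  split_ifs <;> rfl

theorem shiftRel_g {i : ℕ} {hi : 1 ≤ i} {hin : i + 3 ≤ n} (x : (g i hi hin).dom) :
    ShiftRel i x.1.val ((g i hi hin).toFun x).val := by
  have := mem_g_dom.1 x.2
  rw [g_apply_val]
  unfold ShiftRel
  split_ifs <;> omega

theorem shiftRel_f {i : ℕ} {hi : 1 ≤ i} {hin : i + 3 ≤ n} (x : (f i hi hin).dom) :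
    ShiftRel i ((f i hi hin).toFun x).val x.1.val := by
  have := mem_f_dom.1 x.2
  rw [f_apply_val]
  unfold ShiftRel
  split_ifs <;> omega

theorem ShiftRel.right_unique {i u v w : ℕ} (h₁ : ShiftRel i u v) (h₂ : ShiftRel i u w) :
    v = w := by
  unfold ShiftRel at *; omega

theorem ShiftRel.left_unique {i u v w : ℕ} (h₁ : ShiftRel i u w) (h₂ : ShiftRel i v w) :
    u = v := by
  unfold ShiftRel at *; omega

/-- The composition of a homomorphism with a partial endomorphism whose domain contains its
range. -/
def PartialEnd.comp (p : PartialEnd n) (x : HeytingHom A (C n)) (hx : ∀ a, x a ∈ p.dom) :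
    HeytingHom A (C n) :=
  -- The lifted operation does not depend on the rest of the alter ego, so one with `p` alone serves
  -- for all.
  (D ⟨∅, {p}⟩ A).pop ⟨p, rfl⟩ ⟨x, hx⟩

/-- The relation `R` on the chain is preserved by the map `ψ`. -/
def PreservesRel (ψ : HeytingHom A (C n) → C n) (R : ℕ → ℕ → Prop) : Prop :=
  ∀ x y : HeytingHom A (C n), (∀ a, R (x a).val (y a).val) → R (ψ x).val (ψ y).val

theorem preservesRel_shift_of_mem {M : AlterEgo n} (φ : E (D M A)) {i : ℕ} {hi : 1 ≤ i}
    {hin : i + 3 ≤ n} (hp : f i hi hin ∈ M.H ∨ g i hi hin ∈ M.H) :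
    PreservesRel φ.fn (ShiftRel i) := by
  intro x y hxy
  rcases hp with hp | hp
  · have hy : ∀ a, y a ∈ (f i hi hin).dom := fun a => by
      have := hxy a
      rw [mem_f_dom]; unfold ShiftRel at this; omega
    have hfy : (f i hi hin).comp y hy = x := by
      ext a
      exact (shiftRel_f ⟨y a, hy a⟩).left_unique (hxy a)
    have key : φ.fn x = (f i hi hin).toFun ⟨φ.fn y, φ.fn_pdom ⟨_, hp⟩ ⟨y, hy⟩⟩ := by
      rw [← hfy]; exact φ.fn_pop ⟨_, hp⟩ ⟨y, hy⟩
    rw [key]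
    exact shiftRel_f ⟨φ.fn y, _⟩
  · have hx : ∀ a, x a ∈ (g i hi hin).dom := fun a => by
      have := hxy a
      rw [mem_g_dom]; unfold ShiftRel at this; omega
    have hgx : (g i hi hin).comp x hx = y := by
      ext a
      exact (shiftRel_g ⟨x a, hx a⟩).right_unique (hxy a)
    have key : φ.fn y = (g i hi hin).toFun ⟨φ.fn x, φ.fn_pdom ⟨_, hp⟩ ⟨x, hx⟩⟩ := by
      rw [← hgx]; exact φ.fn_pop ⟨_, hp⟩ ⟨x, hx⟩
    rw [key]
    exact shiftRel_g ⟨φ.fn x, _⟩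

theorem preservesRel_raise_of_mem {M : AlterEgo n} (φ : E (D M A)) {j : ℕ} {hj : 1 ≤ j}
    {hjn : j + 2 ≤ n} (hp : h j hj hjn ∈ M.G) : PreservesRel φ.fn (RaiseRel n j) := by
  intro x y hxy
  have hy : (h j hj hjn).comp x = y := by
    ext a
    have h₁ := raiseRel_h j hj hjn (x a)
    have h₂ := hxy a
    change (h j hj hjn (x a)).val = _
    unfold RaiseRel at h₁ h₂
    omega
  have key : φ.fn y = h j hj hjn (φ.fn x) := by
    rw [← hy]; exact φ.fn_op ⟨_, hp⟩ x
  rw [key]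
  exact raiseRel_h j hj hjn _

/-- The range of `h j` misses `j` and `g j ∘ h j = h (j + 1)`; the range of `h (j + 1)` misses `j +
1` and `f j ∘ h (j + 1) = h j`. In each direction the composite passes through an intermediate
homomorphism. -/
theorem preservesRel_raise_succ {ψ : HeytingHom A (C n) → C n} {j : ℕ} (hj : 1 ≤ j)
    (hjn : j + 3 ≤ n) (hs : PreservesRel ψ (ShiftRel j)) :
    PreservesRel ψ (RaiseRel n j) ↔ PreservesRel ψ (RaiseRel n (j + 1)) := by
  constructor
  · intro hr x y hxy
    have h₁ : ∀ a, RaiseRel n j (x a).val ((h j hj (by omega)).comp x a).val :=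
      fun a => raiseRel_h j hj (by omega) (x a)
    have h₂ := hr x _ h₁
    have h₃ := hs ((h j hj (by omega)).comp x) y fun a => by
      have := h₁ a
      have := hxy a
      unfold RaiseRel at *; unfold ShiftRel; omega
    unfold RaiseRel at *; unfold ShiftRel at h₃; omega
  · intro hr x y hxy
    have h₁ : ∀ a, RaiseRel n (j + 1) (x a).val ((h (j + 1) (by omega) (by omega)).comp x a).val :=
      fun a => raiseRel_h (j + 1) (by omega) (by omega) (x a)
    have h₂ := hr x _ h₁
    have h₃ := hs y ((h (j + 1) (by omega) (by omega)).comp x) fun a => by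
      have := h₁ a
      have := hxy a
      unfold RaiseRel at *; unfold ShiftRel; omega
    unfold RaiseRel at *; unfold ShiftRel at h₃; omega

theorem preservesRel_raise_one_iff {ψ : HeytingHom A (C n) → C n}
    (hs : ∀ i, 1 ≤ i → i + 3 ≤ n → PreservesRel ψ (ShiftRel i)) {j : ℕ} (hj : 1 ≤ j)
    (hjn : j + 2 ≤ n) : PreservesRel ψ (RaiseRel n 1) ↔ PreservesRel ψ (RaiseRel n j) := by
  induction j, hj using Nat.le_induction with
  | base => rfl
  | succ k hk ih =>
    exact (ih (by omega)).trans (preservesRel_raise_succ hk (by omega) (hs k hk (by omega)))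

end Relations

/-! ### Prime filters and interpolation at two points. -/

section Interpolation

variable {n : ℕ} [NeZero n] {A : Type u} [HeytingAlgebra A]

theorem apply_himp_eq_top_iff (x : HeytingHom A (C n)) (a b : A) :
    (x (a ⇨ b)).val = n - 1 ↔ (x a).val ≤ (x b).val := by
  rw [map_himp, ← top_val, ← Fin.ext_iff, himp_eq_top_iff, Fin.le_def]

/-- The preimage of the top determines the order of all values, because `a ⇨ b` is sent to the top
exactly when the value at `a` is at most the value at `b`. -/
theorem apply_le_iff_of_top_iff {x y : HeytingHom A (C n)}
    (hxy : ∀ a, (x a).val = n - 1 ↔ (y a).val = n - 1) (a b : A) :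
    (x a).val ≤ (x b).val ↔ (y a).val ≤ (y b).val := by
  rw [← apply_himp_eq_top_iff, ← apply_himp_eq_top_iff, hxy]

theorem apply_bot_val (x : HeytingHom A (C n)) : (x ⊥).val = 0 := by
  rw [map_bot, bot_val]

/-- The holes in the range of `x` lie above all other values except the top. -/
def IsCompressed (x : HeytingHom A (C n)) : Prop :=
  ∀ a, (x a).val + 1 < n → 0 < (x a).val → ∃ b, (x b).val + 1 = (x a).val

/-- Without holes below the top, `x` takes the least values that the common order pattern permits:
each step up in `x` forces at least one step up in `y`. -/
theorem IsCompressed.le_of_top_iff {x y : HeytingHom A (C n)} (hx : IsCompressed x)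
    (hxy : ∀ a, (x a).val = n - 1 ↔ (y a).val = n - 1) (a : A) : (x a).val ≤ (y a).val := by
  obtain ⟨k, hk⟩ : ∃ k, (x a).val = k := ⟨_, rfl⟩
  induction k generalizing a with
  | zero => omega
  | succ k ih =>
    have := (x a).isLt
    by_cases hlt : (x a).val + 1 < n
    · obtain ⟨b, hb⟩ := hx a hlt (by omega)
      have h₁ := ih b (by omega)
      have h₂ := apply_le_iff_of_top_iff hxy a b
      omega
    · have := hxy a
      omega

theorem IsCompressed.eq_of_top_iff {x y : HeytingHom A (C n)} (hx : IsCompressed x)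
    (hy : IsCompressed y) (hxy : ∀ a, (x a).val = n - 1 ↔ (y a).val = n - 1) : x = y := by
  ext a
  exact le_antisymm (hx.le_of_top_iff hxy a) (hy.le_of_top_iff (fun a => (hxy a).symm) a)

theorem exists_finset_apply_eq (x : HeytingHom A (C n)) :
    ∃ T : Finset A, ∀ a, ∃ t ∈ T, x t = x a := by
  classical
  -- For a value that is not attained, `Function.invFun` gives an arbitrary element, which is
  -- harmless in `T`.
  exact ⟨Finset.univ.image (Function.invFun x), fun a =>
    ⟨_, Finset.mem_image_of_mem _ (Finset.mem_univ (x a)), Function.invFun_eq ⟨a, rfl⟩⟩⟩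

/-- Apply `g i` whenever the value `i` is missing just below an attained value `i + 1` other than
the top. This neither creates nor destroys top values, of `x` or of `ψ`. -/
theorem exists_isCompressed {ψ : HeytingHom A (C n) → C n}
    (hs : ∀ i, 1 ≤ i → i + 3 ≤ n → PreservesRel ψ (ShiftRel i)) (x : HeytingHom A (C n)) :
    ∃ y, IsCompressed y ∧ (∀ a, (x a).val = n - 1 ↔ (y a).val = n - 1) ∧
      ((ψ x).val = n - 1 ↔ (ψ y).val = n - 1) := by
  obtain ⟨T, hT⟩ := exists_finset_apply_eq x
  -- As `A` may be infinite, the decreasing measure sums values over one finite set of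
  -- representatives. The same `T` serves throughout, since each new homomorphism is a function of
  -- the previous one.
  obtain ⟨N, hN⟩ : ∃ N, ∑ t ∈ T, (x t).val = N := ⟨_, rfl⟩
  induction N using Nat.strong_induction_on generalizing x with
  | _ N ih =>
  by_cases hc : IsCompressed x
  · exact ⟨x, hc, fun _ => Iff.rfl, Iff.rfl⟩
  unfold IsCompressed at hc
  push Not at hc
  obtain ⟨a, han, ha0, hb⟩ := hc
  obtain ⟨i, hi⟩ : ∃ i, (x a).val = i + 1 := ⟨(x a).val - 1, by omega⟩
  have hi0 : 1 ≤ i := by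
    have := hb ⊥
    rw [apply_bot_val] at this
    omega
  have hin : i + 3 ≤ n := by omega
  have hx : ∀ b, x b ∈ (g i hi0 hin).dom := fun b => by
    have := hb b
    rw [mem_g_dom]; omega
  have hrel : ∀ b, ShiftRel i (x b).val ((g i hi0 hin).comp x hx b).val :=
    fun b => shiftRel_g ⟨x b, hx b⟩
  have hψ := hs i hi0 hin x _ hrel
  generalize (g i hi0 hin).comp x hx = x' at hrel hψ
  have hlt : ∑ t ∈ T, (x' t).val < ∑ t ∈ T, (x t).val := by
    obtain ⟨t, ht, hta⟩ := hT a
    refine Finset.sum_lt_sum (fun t _ => ?_) ⟨t, ht, ?_⟩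
    · have := hrel t
      unfold ShiftRel at this; omega
    · have := hrel t
      rw [hta, hi] at this
      rw [hta]
      unfold ShiftRel at this; omega
  obtain ⟨y, hy, hy₁, hy₂⟩ := ih _ (hN ▸ hlt) x' (fun b => by
    obtain ⟨t, ht, htb⟩ := hT b
    refine ⟨t, ht, Fin.ext ((hrel t).right_unique ?_)⟩
    rw [htb]
    exact hrel b) rfl
  refine ⟨y, hy, fun b => (Iff.trans ?_ (hy₁ b)), Iff.trans ?_ hy₂⟩
  · have := hrel b
    unfold ShiftRel at this; omega
  · unfold ShiftRel at hψ; omega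

/-- Compose with `h i`, `h (i + 1)`, …, `h (n - 2)` in turn: `i ≤ u` holds exactly when the image of
`u` under `h i` is at least `i + 1`. -/
theorem exists_raise_to_top {ψ : HeytingHom A (C n) → C n}
    (hr : ∀ j, 1 ≤ j → j + 2 ≤ n → PreservesRel ψ (RaiseRel n j)) (x : HeytingHom A (C n))
    {i : ℕ} (hi : 1 ≤ i) (hin : i + 1 ≤ n) :
    ∃ y : HeytingHom A (C n), (∀ a, i ≤ (x a).val ↔ (y a).val = n - 1) ∧
      (i ≤ (ψ x).val ↔ (ψ y).val = n - 1) := by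
  obtain ⟨k, hk⟩ : ∃ k, i + 1 + k = n := ⟨n - (i + 1), by omega⟩
  induction k generalizing i x with
  | zero =>
    refine ⟨x, fun a => ?_, ?_⟩
    · have := (x a).isLt
      omega
    · have := (ψ x).isLt
      omega
  | succ k ih =>
    have hrel : ∀ a, RaiseRel n i (x a).val ((h i hi (by omega)).comp x a).val :=
      fun a => raiseRel_h i hi (by omega) (x a)
    have hψ := hr i hi (by omega) x _ hrel
    obtain ⟨y, hy₁, hy₂⟩ := ih ((h i hi (by omega)).comp x) (i := i + 1) (by omega) (by omega)
      (by omega)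
    refine ⟨y, fun a => Iff.trans ?_ (hy₁ a), Iff.trans ?_ hy₂⟩
    · have := (x a).isLt
      have := hrel a
      unfold RaiseRel at this; omega
    · have := (ψ x).isLt
      unfold RaiseRel at hψ; omega

/-- Values of `ψ` at two homomorphisms are linked by the prime filters that these share. -/
theorem le_iff_le_of_preservesRel {ψ : HeytingHom A (C n) → C n}
    (hs : ∀ i, 1 ≤ i → i + 3 ≤ n → PreservesRel ψ (ShiftRel i))
    (hr : ∀ j, 1 ≤ j → j + 2 ≤ n → PreservesRel ψ (RaiseRel n j)) {x y : HeytingHom A (C n)}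
    {i j : ℕ} (hi : 1 ≤ i) (hin : i + 1 ≤ n) (hj : 1 ≤ j) (hjn : j + 1 ≤ n)
    (hxy : ∀ a, i ≤ (x a).val ↔ j ≤ (y a).val) : i ≤ (ψ x).val ↔ j ≤ (ψ y).val := by
  obtain ⟨x₁, hx₁, hψx₁⟩ := exists_raise_to_top hr x hi hin
  obtain ⟨y₁, hy₁, hψy₁⟩ := exists_raise_to_top hr y hj hjn
  obtain ⟨x₂, hxc, hx₂, hψx₂⟩ := exists_isCompressed hs x₁
  obtain ⟨y₂, hyc, hy₂, hψy₂⟩ := exists_isCompressed hs y₁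
  have : x₂ = y₂ := hxc.eq_of_top_iff hyc fun a => by
    rw [← hx₂, ← hy₂, ← hx₁, ← hy₁, hxy]
  rw [hψx₁, hψx₂, this, ← hψy₂, ← hψy₁]

/-- Failure means that `{a | ψ x ≤ x a}` is contained in `{a | ψ y < y a}`. Enlarging the former to
the largest filter `{a | i ≤ x a}` still contained in the latter yields equality, and then `i ≤ ψ x`
would imply `ψ y < ψ y`. -/
theorem exists_le_apply_and_apply_le {ψ : HeytingHom A (C n) → C n}
    (hs : ∀ i, 1 ≤ i → i + 3 ≤ n → PreservesRel ψ (ShiftRel i))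
    (hr : ∀ j, 1 ≤ j → j + 2 ≤ n → PreservesRel ψ (RaiseRel n j)) (x y : HeytingHom A (C n)) :
    ∃ a, ψ x ≤ x a ∧ y a ≤ ψ y := by
  classical
  by_contra! hno
  have hno' : ∀ a, (ψ x).val ≤ (x a).val → (ψ y).val + 1 ≤ (y a).val := fun a ha => hno a ha
  have hP : ∃ i, ∀ a, i ≤ (x a).val → (ψ y).val + 1 ≤ (y a).val := ⟨_, hno'⟩
  set i := Nat.find hP with hidef
  have hiP := Nat.find_spec hP
  rw [← hidef] at hiP
  have hib : i ≤ (ψ x).val := Nat.find_min' hP hno'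
  have hi1 : 1 ≤ i := by
    by_contra hi
    have := hiP ⊥ (by omega)
    rw [apply_bot_val] at this
    omega
  -- By minimality of `i`, level `i - 1` has an element `a` outside the filter of `y`.
  obtain ⟨a, ha, hay⟩ : ∃ a, i - 1 ≤ (x a).val ∧ ¬ (ψ y).val + 1 ≤ (y a).val := by
    have := Nat.find_min hP (m := i - 1) (by omega)
    push Not at this ⊢
    exact this
  have hbn := (ψ x).isLt
  have hyn := (y ⊤).isLt
  have htop := hiP ⊤ (by rw [map_top, top_val]; omega)
  have key := le_iff_le_of_preservesRel hs hr (x := x) (y := y) (i := i) (j := (ψ y).val + 1) hi1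
    (by omega) (by omega) (by omega) fun d => ⟨hiP d, fun hd => by
      by_contra hdi
      -- If `d` is missing from the filter of `x`, then `x d ≤ i - 1 ≤ x a`. So `d ⇨ a` lies in both
      -- filters, and modus ponens would put `a` in the filter of `y`.
      have h₁ : (x (d ⇨ a)).val = n - 1 := (apply_himp_eq_top_iff x d a).2 (by omega)
      have h₂ := hiP (d ⇨ a) (by omega)
      have h₃ : y d ⊓ y (d ⇨ a) ≤ y a := by
        rw [← map_inf]
        exact OrderHomClass.mono y inf_himp_le
      rcases inf_le_iff.1 h₃ with h | h
      · have : (y d).val ≤ (y a).val := h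
        omega
      · have : (y (d ⇨ a)).val ≤ (y a).val := h
        omega⟩
  omega

end Interpolation

/-! ### Compactness of the dual space and the duality. -/

section Duality

variable {n : ℕ} [NeZero n] {A : Type u} [HeytingAlgebra A]

theorem isClosed_range_coe :
    IsClosed (Set.range fun (x : HeytingHom A (C n)) (a : A) => x a) := by
  have hset : (Set.range fun (x : HeytingHom A (C n)) (a : A) => x a) =
      {p : A → C n | p ⊥ = ⊥} ∩ ({p | ∀ a b, p (a ⊔ b) = p a ⊔ p b} ∩
        ({p | ∀ a b, p (a ⊓ b) = p a ⊓ p b} ∩ {p | ∀ a b, p (a ⇨ b) = p a ⇨ p b})) := by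
    ext p
    constructor
    · rintro ⟨x, rfl⟩
      exact ⟨map_bot x, map_sup x, map_inf x, map_himp x⟩
    · rintro ⟨h₀, h₁, h₂, h₃⟩
      exact ⟨{ toFun := p, map_sup' := h₁, map_inf' := h₂, map_bot' := h₀, map_himp' := h₃ }, rfl⟩
  have hop : ∀ (m : C n → C n → C n) (k : A → A → A),
      IsClosed {p : A → C n | ∀ a b, p (k a b) = m (p a) (p b)} := fun m k => by
    simp only [Set.ofPred_forall]
    refine isClosed_iInter fun a => isClosed_iInter fun b => isClosed_eq (continuous_apply _) ?_
    exact (continuous_of_discreteTopology (f := fun q : C n × C n => m q.1 q.2)).comp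
      ((continuous_apply (A := fun _ : A => C n) a).prodMk
        (continuous_apply (A := fun _ : A => C n) b))
  rw [hset]
  exact (isClosed_eq (continuous_apply _) continuous_const).inter
    ((hop _ _).inter ((hop _ _).inter (hop _ _)))

instance (M : AlterEgo n) : CompactSpace (D M A).carrier := by
  have hind : Topology.IsInducing
      (fun (x : (D M A).carrier) (a : A) => (show HeytingHom A (C n) from x) a) := ⟨rfl⟩
  exact (Topology.IsClosedEmbedding.mk ⟨hind, DFunLike.coe_injective (F := HeytingHom A (C n))⟩
    isClosed_range_coe).compactSpace

theorem continuous_eval (M : AlterEgo n) (a : A) :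
    Continuous fun x : (D M A).carrier => (show HeytingHom A (C n) from x) a :=
  (evalHom M A a).continuous_fn

theorem evalHom_injective (M : AlterEgo n) (hA : InISP n A) :
    Function.Injective (evalHom M A) := by
  obtain ⟨I, e, he⟩ := hA
  intro a b hab
  refine he (funext fun k => ?_)
  let x : HeytingHom A (C n) :=
    { toFun := fun a => e a k
      map_sup' := fun a b => congrFun (map_sup e a b) k
      map_inf' := fun a b => congrFun (map_inf e a b) k
      map_bot' := congrFun (map_bot e) k
      map_himp' := fun a b => congrFun (map_himp e a b) k }
  exact congrFun (congrArg E.fn hab) x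

/-- A lattice form of the Stone–Weierstrass theorem. -/
theorem exists_evalHom_eq {M : AlterEgo n} (φ : E (D M A))
    (hφ : ∀ x y : HeytingHom A (C n), ∃ a, φ.fn x ≤ x a ∧ y a ≤ φ.fn y) :
    ∃ a, evalHom M A a = φ := by
  classical
  choose c hc₁ hc₂ using hφ
  have hopen : ∀ (r : C n → C n → Prop) (a : A),
      IsOpen {z : (D M A).carrier | r ((show HeytingHom A (C n) from z) a) (φ.fn z)} := fun r a =>
    (isOpen_discrete {q : C n × C n | r q.1 q.2}).preimage
      ((continuous_eval M a).prodMk φ.continuous_fn)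
  -- Fix `x` and cover the space by the sets where `c x y` is below `φ`. A finite meet is then below
  -- `φ` everywhere and still large enough at `x`; a finite join of such meets, taken over `x`,
  -- finally equals `φ`.
  have hlow : ∀ x : HeytingHom A (C n), ∃ a, φ.fn x ≤ x a ∧
      ∀ z : HeytingHom A (C n), z a ≤ φ.fn z := fun x => by
    obtain ⟨t, ht⟩ := isCompact_univ.elim_finite_subcover
      (fun y : HeytingHom A (C n) => {z : (D M A).carrier |
        (show HeytingHom A (C n) from z) (c x y) ≤ φ.fn z}) (fun y => hopen (· ≤ ·) _)
      (fun z _ => Set.mem_iUnion.2 ⟨z, hc₂ x z⟩)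
    refine ⟨t.inf (c x), ?_, fun z => ?_⟩
    · rw [map_finset_inf]
      exact Finset.le_inf fun y _ => hc₁ x y
    · obtain ⟨y, hy, hz⟩ := Set.mem_iUnion₂.1 (ht (Set.mem_univ z))
      exact (OrderHomClass.mono z (Finset.inf_le hy)).trans hz
  choose b hb₁ hb₂ using hlow
  obtain ⟨t, ht⟩ := isCompact_univ.elim_finite_subcover
    (fun x : HeytingHom A (C n) => {z : (D M A).carrier |
      φ.fn z ≤ (show HeytingHom A (C n) from z) (b x)}) (fun x => hopen (fun u v => v ≤ u) _)
    (fun z _ => Set.mem_iUnion.2 ⟨z, hb₁ z⟩)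
  refine ⟨t.sup b, E.fn_injective (funext fun z => ?_)⟩
  change (show HeytingHom A (C n) from z) (t.sup b) = φ.fn z
  apply le_antisymm
  · rw [map_finset_sup]
    exact Finset.sup_le fun x _ => hb₂ x z
  · obtain ⟨x, hx, hz⟩ := Set.mem_iUnion₂.1 (ht (Set.mem_univ z))
    exact le_trans hz
      (OrderHomClass.mono (show HeytingHom A (C n) from z) (Finset.le_sup (f := b) hx))

theorem yieldsDuality_of_mem_Sigma {σ : (Fin (n - 3) → PartialEnd n) × HeytingHom (C n) (C n)}
    (hσ : σ ∈ Sigma n) : YieldsDuality.{u} (alterEgo σ) := by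
  intro A _ hA
  refine ⟨evalHom_injective _ hA, fun φ => ?_⟩
  have hs : ∀ i, 1 ≤ i → i + 3 ≤ n → PreservesRel φ.fn (ShiftRel i) := fun i hi hin => by
    obtain ⟨k, rfl⟩ : ∃ k, i = k + 1 := ⟨i - 1, by omega⟩
    refine preservesRel_shift_of_mem φ (hi := hi) (hin := hin) ?_
    have hk : σ.1 ⟨k, by omega⟩ ∈ (alterEgo σ).H := Set.mem_range_self _
    rcases hσ.1 ⟨k, by omega⟩ with h | h
    · exact .inl (h ▸ hk)
    · exact .inr (h ▸ hk)
  have hr : ∀ j, 1 ≤ j → j + 2 ≤ n → PreservesRel φ.fn (RaiseRel n j) := by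
    obtain ⟨j, hj, hjn, hσj⟩ := hσ.2
    have := preservesRel_raise_of_mem φ (j := j) (hj := hj) (hjn := hjn) hσj.symm
    intro j' hj' hjn'
    -- Pass from the given index `j` to any `j'` through index `1`.
    exact (preservesRel_raise_one_iff hs hj' hjn').1 ((preservesRel_raise_one_iff hs hj hjn).2 this)
  exact exists_evalHom_eq φ (exists_le_apply_and_apply_le hs hr)

end Duality

/-! ### Distinctness and number of the alter egos. -/

section Counting

variable {n : ℕ} [NeZero n]

/-- The arguments and values of a partial endomorphism at the elements that it moves. -/
def PartialEnd.moved (p : PartialEnd n) : Set (ℕ × ℕ) :=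
  {q | q.1 ≠ q.2 ∧ ∃ x : p.dom, x.1.val = q.1 ∧ (p.toFun x).val = q.2}

theorem moved_f {i : ℕ} {hi : 1 ≤ i} {hin : i + 3 ≤ n} : (f i hi hin).moved = {(i, i + 1)} := by
  ext ⟨u, v⟩
  simp only [PartialEnd.moved, f_apply_val, Set.mem_ofPred_eq, Set.mem_singleton_iff, Prod.mk.injEq]
  constructor
  · rintro ⟨huv, x, hx, hv⟩
    split_ifs at hv <;> omega
  · rintro ⟨rfl, rfl⟩
    exact ⟨by omega, ⟨⟨u, by omega⟩, mem_f_dom.2 (by simp)⟩, rfl, if_pos rfl⟩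

theorem moved_g {i : ℕ} {hi : 1 ≤ i} {hin : i + 3 ≤ n} : (g i hi hin).moved = {(i + 1, i)} := by
  ext ⟨u, v⟩
  simp only [PartialEnd.moved, g_apply_val, Set.mem_ofPred_eq, Set.mem_singleton_iff, Prod.mk.injEq]
  constructor
  · rintro ⟨huv, x, hx, hv⟩
    split_ifs at hv <;> omega
  · rintro ⟨rfl, rfl⟩
    exact ⟨by omega, ⟨⟨v + 1, by omega⟩, mem_g_dom.2 (by simp)⟩, rfl, if_pos rfl⟩

/-- One of `f_i` and `g_i`. -/
noncomputable def shift (c : Bool) (i : ℕ) (hi : 1 ≤ i) (hin : i + 3 ≤ n) : PartialEnd n :=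
  if c then f i hi hin else g i hi hin

/-- The unique moved pair is `(i, i + 1)` for `f i` and `(i + 1, i)` for `g i`, so it shows both the
direction and the index. -/
theorem shift_inj {c c' : Bool} {i i' : ℕ} {hi : 1 ≤ i} {hin : i + 3 ≤ n} {hi' : 1 ≤ i'}
    {hin' : i' + 3 ≤ n} (heq : shift c i hi hin = shift c' i' hi' hin') : c = c' ∧ i = i' := by
  have := congrArg PartialEnd.moved heq
  cases c <;> cases c' <;>
    simp [shift, moved_f, moved_g] at this ⊢ <;> omega

theorem h_inj {i j : ℕ} {hi : 1 ≤ i} {hin : i + 2 ≤ n} {hj : 1 ≤ j} {hjn : j + 2 ≤ n}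
    (heq : h i hi hin = h j hj hjn) : i = j := by
  have h₁ := congrArg Fin.val (DFunLike.congr_fun heq (⟨i, by omega⟩ : C n))
  -- The smaller index is moved by its own map and fixed by the other.
  have h₂ := congrArg Fin.val (DFunLike.congr_fun heq (⟨j, by omega⟩ : C n))
  rw [h_apply_val, h_apply_val] at h₁ h₂
  dsimp only at h₁ h₂
  split_ifs at h₁ h₂ <;> omega

variable (n) in
/-- The member of `Σ_n` with the given choices of components. -/
noncomputable def sigmaOf (q : (Fin (n - 3) → Bool) × Fin (n - 2)) :
    (Fin (n - 3) → PartialEnd n) × HeytingHom (C n) (C n) :=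
  (fun k => shift (q.1 k) (k.val + 1) (by omega) (by omega),
    h (q.2.val + 1) (by omega) (by omega))

theorem range_sigmaOf : Set.range (sigmaOf n) = Sigma n := by
  classical
  ext ⟨s, e⟩
  constructor
  · rintro ⟨⟨q, j⟩, hq⟩
    cases hq
    refine ⟨fun k => ?_, _, by omega, by omega, rfl⟩
    cases hk : q k
    · right; simp [hk, shift]
    · left; simp [hk, shift]
  · rintro ⟨hs, j, hj, hjn, he⟩
    dsimp only at hs he
    refine ⟨(fun k => decide (s k = f (k.val + 1) (by omega) (by omega)),
      ⟨j - 1, by omega⟩), Prod.ext (funext fun k => ?_) ?_⟩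
    · by_cases hk : s k = f (k.val + 1) (by omega) (by omega)
      · simp [sigmaOf, shift, hk]
      · simp only [sigmaOf, shift, hk, decide_false, Bool.false_eq_true, if_false]
        exact ((hs k).resolve_left hk).symm
    · subst he
      obtain ⟨k, rfl⟩ : ∃ k, j = k + 1 := ⟨j - 1, by omega⟩
      rfl

theorem sigmaOf_fst_injective (q : (Fin (n - 3) → Bool) × Fin (n - 2)) :
    Function.Injective (sigmaOf n q).1 := fun k l hkl => by
  have := (shift_inj hkl).2
  exact Fin.ext (by omega)

/-- Although an alter ego keeps only the unindexed set of components, each component carries its own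
index, so the tuple can be recovered. -/
theorem alterEgo_sigmaOf_injective : Function.Injective fun q => alterEgo (sigmaOf n q) := by
  rintro ⟨q, i⟩ ⟨r, j⟩ heq
  have hH : Set.range (sigmaOf n (q, i)).1 = Set.range (sigmaOf n (r, j)).1 :=
    congrArg AlterEgo.H heq
  have hG : (sigmaOf n (q, i)).2 = (sigmaOf n (r, j)).2 :=
    Set.singleton_injective (congrArg AlterEgo.G heq)
  refine Prod.ext (funext fun k => ?_) (Fin.ext ?_)
  · obtain ⟨l, hl⟩ : (sigmaOf n (q, i)).1 k ∈ Set.range (sigmaOf n (r, j)).1 :=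
      hH ▸ Set.mem_range_self k
    obtain ⟨h₁, h₂⟩ := shift_inj hl
    obtain rfl : l = k := Fin.ext (by omega)
    exact h₁.symm
  · have := h_inj (hi := by omega) (hin := by omega) (hj := by omega) (hjn := by omega) hG
    dsimp only at this ⊢
    omega

theorem ncard_alterEgo_H {σ : (Fin (n - 3) → PartialEnd n) × HeytingHom (C n) (C n)}
    (hσ : σ ∈ Sigma n) : (alterEgo σ).H.ncard = n - 3 := by
  rw [← range_sigmaOf] at hσ
  obtain ⟨q, rfl⟩ := hσ
  change (Set.range (sigmaOf n q).1).ncard = _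
  rw [← Set.image_univ, Set.ncard_image_of_injective _ (sigmaOf_fst_injective q),
    Set.ncard_univ, Nat.card_fin]

theorem ncard_image_alterEgo : (alterEgo '' Sigma n).ncard = 2 ^ (n - 3) * (n - 2) := by
  rw [← range_sigmaOf, ← Set.range_comp, ← Set.image_univ]
  refine (Set.ncard_image_of_injective _ alterEgo_sigmaOf_injective).trans ?_
  simp [Set.ncard_univ]

end Counting

end GoedelDuality

theorem theorem3p3 (n : ℕ) [NeZero n] (hn : 4 ≤ n) :
    (∀ σ ∈ GoedelDuality.Sigma n,
      GoedelDuality.YieldsDuality.{u} (GoedelDuality.alterEgo σ) ∧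
      (GoedelDuality.alterEgo σ).H.ncard = n - 3 ∧
      (GoedelDuality.alterEgo σ).G.ncard = 1) ∧
    (GoedelDuality.alterEgo '' GoedelDuality.Sigma n).ncard = 2 ^ (n - 3) * (n - 2) :=
  ⟨fun _ hσ => ⟨GoedelDuality.yieldsDuality_of_mem_Sigma hσ, GoedelDuality.ncard_alterEgo_H hσ,
    Set.ncard_singleton _⟩, GoedelDuality.ncard_image_alterEgo⟩
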